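/- Throughout, $\log=\log_2$, Hilbert spaces are finite-dimensional, $\|A\|_{\mathrm{tr}}=\operatorname{tr}\sqrt{A^\dagger A}$, $\rho_{U_m}$ is the fully mixed state of dimension $2^m$, and $Y$ denotes a uniformly distributed seed on $\{0,1\}^d$, independent of all the other systems, with state $\rho_Y$. For a random variable $X$ with distribution $(p_x)$ put $H_{\min}(X)=-\log\max_x p_x$. For a (possibly sub-normalized) state $\rho_{AB}$, i.e. $\rho_{AB}\ge 0$ with $\operatorname{tr}\rho_{AB}\le 1$, let $H_{\min}(A|B)_\rho$ be the supremum of all $\lambda\in\mathbb R$ for which there is a state $\sigma_B\ge 0$, $\operatorname{tr}\sigma_B=1$, with $2^{-\lambda}\,\mathbb 1_A\otimes\sigma_B\ge\rho_{AB}$. A function $\mathrm{Ext}:\{0,1\}^n\times\{0,1\}^d\to\{0,1\}^m$ is a *$(k,\varepsilon)$-strong extractor with uniform seed* if $\tfrac12\|\rho_{\mathrm{Ext}(X,Y)Y}-\rho_{U_m}\otimes\rho_Y\|_{\mathrm{tr}}\le\varepsilon$ for every random variable $X$ on $\{0,1\}^n$ with $H_{\min}(X)\ge k$. It is a *quantum-proof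 $(k,\varepsilon)$-strong extractor with uniform seed* if $\tfrac12\|\rho_{\mathrm{Ext}(X,Y)YE}-\rho_{U_m}\otimes\rho_Y\otimes\rho_E\|_{\mathrm{tr}}\le\varepsilon$ for every quantum system $E$ and every (possibly sub-normalized) state $\rho_{XE}=\sum_{x\in\{0,1\}^n}|x\rangle\langle x|\otimes\hat\rho^{\,x}_E$ classical on $X$ with $H_{\min}(X|E)_\rho\ge k$; here $\rho_{\mathrm{Ext}(X,Y)YE}=\sum_{x,y}2^{-d}\,|\mathrm{Ext}(x,y)\rangle\langle \mathrm{Ext}(x,y)|\otimes|y\rangle\langle y|\otimes\hat\rho^{\,x}_E$ and $\rho_E=\sum_x\hat\rho^{\,x}_E$. Sets $S_1,\dots,S_m\subset[d]=\{1,\dots,d\}$ form a *weak $(t,r)$-design* if for all $i$, $|S_i|=t$ and $\sum_{j=1}^{i-1}2^{|S_j\cap S_i|}\le rm$. For $y\in\{0,1\}^d$, $y_{S}$ denotes the string formed by the bits of $y$ at the positions in $S$. **Theorem.** Let $k\in\mathbb R$ and $\varepsilon>0$, let $C:\{0,1\}^n\times\{0,1\}^t\to\{0,1\}$ be a $(k,\varepsilon)$-strong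 extractor with uniform seed, and let $S_1,\dots,S_m\subset[d]$ be a weak $(t,r)$-design, $r\in\mathbb R$. Then the function $\mathrm{Ext}_C:\{0,1\}^n\times\{0,1\}^d\to\{0,1\}^m$, $\mathrm{Ext}_C(x,y)=C(x,y_{S_1})\cdots C(x,y_{S_m})$, is a quantum-proof $(k+rm+\log\tfrac1\varepsilon,\;3m\sqrt\varepsilon)$-strong extractor with uniform seed. -/

import Mathlib

open scoped Matrix Kronecker MatrixOrder ComplexOrder

noncomputable section

namespace Trevisan

/-- `{0,1}^n`. -/
abbrev BitString (n : ℕ) : Type := Fin n → Bool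

/-! ### Finite-dimensional quantum states

Operators on the Hilbert space with orthonormal basis `{|a⟩ : a ∈ A}`, for a finite type `A`, are
complex matrices indexed by `A`; the tensor product of two systems is indexed by `A × B`. -/

/-- Normalized states: positive semidefinite operators of trace one. -/
def IsNormalizedState {A : Type} [Fintype A] (ρ : Matrix A A ℂ) : Prop :=
  ρ.PosSemidef ∧ ρ.trace = 1

/-- Sub-normalized states: positive semidefinite operators of trace at most one. -/
def IsSubnormalizedState {A : Type} [Fintype A] (ρ : Matrix A A ℂ) : Prop :=
  ρ.PosSemidef ∧ ρ.trace.re ≤ 1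

/-- The trace norm `‖M‖_tr = tr √(M† M)`. -/
def traceNorm {A : Type} [Fintype A] [DecidableEq A] (M : Matrix A A ℂ) : ℝ :=
  (CFC.sqrt (Mᴴ * M)).trace.re

/-- The projector `|x⟩⟨x|`. -/
def proj {X : Type} [DecidableEq X] (x : X) : Matrix X X ℂ := Matrix.single x x 1

/-- The fully mixed state on the system with basis `Z`. -/
def fullyMixed (Z : Type) [Fintype Z] [DecidableEq Z] : Matrix Z Z ℂ :=
  (Fintype.card Z : ℂ)⁻¹ • (1 : Matrix Z Z ℂ)

/-- The operator `(⟨a| ⊗ 1) ρ_{AB} (|a⟩ ⊗ 1)` on `B`. -/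
def diagBlock {A B : Type} (ρ : Matrix (A × B) (A × B) ℂ) (a : A) : Matrix B B ℂ :=
  Matrix.of fun b b' => ρ (a, b) (a, b')

/-- The reduced state `ρ_B = tr_A ρ_{AB}`. -/
def traceLeft {A B : Type} [Fintype A] (ρ : Matrix (A × B) (A × B) ℂ) : Matrix B B ℂ :=
  ∑ a, diagBlock ρ a

/-- `ρ_{XE}` is classical on `X`: it has the form `∑ₓ |x⟩⟨x| ⊗ ρ̂ˣ`, where necessarily
`ρ̂ˣ = pₓ ρˣ` is its diagonal block at `x`. -/
def IsClassicalOnLeft {X E : Type} [Fintype X] [DecidableEq X]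
    (ρ : Matrix (X × E) (X × E) ℂ) : Prop :=
  ρ = ∑ x, proj x ⊗ₖ diagBlock ρ x

/-! ### Min-entropy -/

/-- The min-entropy `H_min(X) = - log maxₓ pₓ` of a distribution `p` on a finite set. -/
def minEntropy {X : Type} (p : X → ℝ) : ℝ := -Real.logb 2 (⨆ x, p x)

/-- The conditional min-entropy `H_min(A|B)`: the largest `l` such that
`2^{-l} 1_A ⊗ σ_B ≥ ρ_{AB}` for some normalized state `σ_B`. It is an extended real number
because it is `+∞` at `ρ = 0`. -/
def condMinEntropy {A B : Type} [Fintype A] [DecidableEq A] [Fintype B]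
    (ρ : Matrix (A × B) (A × B) ℂ) : EReal :=
  sSup ((fun l : ℝ => (l : EReal)) '' {l : ℝ | ∃ σ : Matrix B B ℂ, IsNormalizedState σ ∧
    ρ ≤ (((2 : ℝ) ^ (-l) : ℝ) : ℂ) • ((1 : Matrix A A ℂ) ⊗ₖ σ)})

/-! ### Extractors -/

/-- `ρ_{Ext(X,Y) Y}` for `X` with distribution `p` and an independent uniform seed `Y`. -/
def outputSeedState {X Y Z : Type} [Fintype X] [Fintype Y] [DecidableEq Y] [DecidableEq Z]
    (Ext : X → Y → Z) (p : X → ℝ) : Matrix (Z × Y) (Z × Y) ℂ :=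
  ∑ x, ∑ y, ((p x : ℂ) * (Fintype.card Y : ℂ)⁻¹) • (proj (Ext x y) ⊗ₖ proj y)

/-- `ρ_{Ext(X,Y) Y E}` for a state `ρ_{XE}` classical on `X` and a uniform seed `Y` independent
of `XE`. -/
def outputSeedSideState {X Y Z E : Type} [Fintype X] [Fintype Y] [DecidableEq Y] [DecidableEq Z]
    (Ext : X → Y → Z) (ρ : Matrix (X × E) (X × E) ℂ) : Matrix (Z × Y × E) (Z × Y × E) ℂ :=
  ∑ x, ∑ y, (Fintype.card Y : ℂ)⁻¹ • (proj (Ext x y) ⊗ₖ (proj y ⊗ₖ diagBlock ρ x))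

/-- `(k, ε)`-strong extractors with uniform seed (without side information). The output alphabet
`Z` is `Bool` for one-bit extractors and `BitString m` for `m`-bit extractors. -/
def IsStrongExtractor {n d : ℕ} {Z : Type} [Fintype Z] [DecidableEq Z] (k ε : ℝ)
    (Ext : BitString n → BitString d → Z) : Prop :=
  ∀ p ∈ stdSimplex ℝ (BitString n), k ≤ minEntropy p →
    1 / 2 * traceNorm (outputSeedState Ext p - fullyMixed Z ⊗ₖ fullyMixed (BitString d)) ≤ ε

/-- Quantum-proof `(k, ε)`-strong extractors with uniform seed: the side information `E` is an
arbitrary finite-dimensional quantum system, and `ρ_{XE}` an arbitrary (possibly sub-normalized)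
state classical on `X`. -/
def IsQuantumProofStrongExtractor {n d : ℕ} {Z : Type} [Fintype Z] [DecidableEq Z] (k ε : ℝ)
    (Ext : BitString n → BitString d → Z) : Prop :=
  ∀ (E : Type) [Fintype E] [DecidableEq E] (ρ : Matrix (BitString n × E) (BitString n × E) ℂ),
    IsSubnormalizedState ρ → IsClassicalOnLeft ρ → (k : EReal) ≤ condMinEntropy ρ →
    1 / 2 * traceNorm (outputSeedSideState Ext ρ -
      fullyMixed Z ⊗ₖ (fullyMixed (BitString d) ⊗ₖ traceLeft ρ)) ≤ ε

/-! ### Weak designs and Trevisan's construction -/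

/-- Weak `(t, r)`-designs `S_1, …, S_m ⊆ [d]`. -/
structure IsWeakDesign {m d : ℕ} (t : ℕ) (r : ℝ) (S : Fin m → Finset (Fin d)) : Prop where
  card_eq : ∀ i, (S i).card = t
  overlap : ∀ i, ∑ j ∈ Finset.Iio i, (2 : ℝ) ^ (S j ∩ S i).card ≤ r * m

/-- The string `y_S` of the bits of `y` at the positions in `S`, in increasing order. -/
def restrict {d t : ℕ} (y : BitString d) (S : Finset (Fin d)) (hS : S.card = t) : BitString t :=
  fun j => y (S.orderEmbOfFin hS j)

/-- `Ext_C(x, y) = C(x, y_{S_1}) ⋯ C(x, y_{S_m})`. -/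
def trevisanExt {n t m d : ℕ} (C : BitString n → BitString t → Bool)
    (S : Fin m → Finset (Fin d)) (hS : ∀ i, (S i).card = t) :
    BitString n → BitString d → BitString m :=
  fun x y i => C x (restrict y (S i) (hS i))

end Trevisan

end

set_option linter.unusedSectionVars false

namespace Trevisan

variable {A B : Type} [Fintype A] [Fintype B]

/-! ### Traces of products of Hermitian matrices -/

/-! Write `M x` for the block of the state at `x`, and `s` for the sign of an output bit. The
entropy assumption gives `M x ≤ c σ` for a state `σ`. Three ideas combine.

One bit, quantum side information. Put `R = √(∑ M x + δ)` and `F x = R⁻¹ (M x) R⁻¹`, the pretty good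
measurement. The bias operator `∑ s(x) M x` equals `R H R` with `H = ∑ s(x) F x`, and `‖R H R‖² ≤ tr
R² · tr (R H R H)`. Expanding the last trace gives, for each `x'`, the bias of `C` on the classical
weight `x ↦ tr (M x F x')`, which is at most `c tr (σ F x')`. So the classical hypothesis on `C`
applies to every `x'`; summing with `∑ F ≤ 1` and letting `δ → 0` bounds the mean square bias
(`sum_sq_traceNorm_bias_le`).

Advice. Splitting the state by the value of a function of `x` keeps every piece below `c σ`, so
`|Γ|` advice values only multiply the term `2^k c` by `|Γ|` (`sum_traceNorm_bias_advice_le`).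

Hybrids. The distance from uniform telescopes over the output bits, bit `i` facing an adversary who
knows the bits before it. With the seed fixed outside `S i`, these are read off truth tables with at
most `r m` entries in total, so `|Γ| ≤ 2^(r m)`. Each bit then costs at most `2 √ε`. -/

lemma trace_mul_re_nonneg {M N : Matrix A A ℂ} (hM : M.PosSemidef) (hN : N.PosSemidef) :
    0 ≤ (M * N).trace.re := by
  classical
  obtain ⟨C, rfl⟩ := CStarAlgebra.nonneg_iff_eq_star_mul_self.mp hM.nonneg
  rw [Matrix.star_eq_conjTranspose, Matrix.mul_assoc, Matrix.trace_mul_comm]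
  exact (Complex.le_def.mp (hN.mul_mul_conjTranspose_same C).trace_nonneg).1

lemma trace_mul_re_mono {M N P : Matrix A A ℂ} (hP : P.PosSemidef) (h : (N - M).PosSemidef) :
    (M * P).trace.re ≤ (N * P).trace.re := by
  have := trace_mul_re_nonneg h hP
  rw [Matrix.sub_mul, Matrix.trace_sub, Complex.sub_re] at this
  linarith

/-- Hermitian operators between `-1` and `1`. -/
def IsContraction [DecidableEq A] (T : Matrix A A ℂ) : Prop :=
  (1 - T).PosSemidef ∧ (1 + T).PosSemidef

variable [DecidableEq A] [DecidableEq B]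

/-- The trace norm of a Hermitian matrix is attained as `tr (H T)` for a Hermitian unitary `T`. -/
lemma exists_traceNorm_eq {H : Matrix A A ℂ} (hH : H.IsHermitian) :
    ∃ T : Matrix A A ℂ, T.IsHermitian ∧ T * T = 1 ∧ traceNorm H = (H * T).trace.re ∧
      (H * T - H).PosSemidef ∧ (H * T + H).PosSemidef := by
  have hsa : IsSelfAdjoint H := hH
  have hfin : (spectrum ℝ H).Finite := Matrix.finite_real_spectrum
  have hc : ∀ f : ℝ → ℝ, ContinuousOn f (spectrum ℝ H) := fun f => hfin.continuousOn f
  -- The value at 0 is 1, so that `s² = 1` everywhere and `cfc s H` is unitary even on the kernel of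
  -- `H`.
  let s : ℝ → ℝ := fun x => if 0 ≤ x then 1 else -1
  have hid : cfc (fun x : ℝ => x) H = H := cfc_id' ℝ H
  have hmul : H * cfc s H = cfc (fun x : ℝ => x * s x) H := by
    rw [cfc_mul (fun x : ℝ => x) s H (hc _) (hc _), hid]
  refine ⟨cfc s H, cfc_predicate s H, ?_, ?_, ?_, ?_⟩
  · rw [← cfc_mul s s H (hc _) (hc _), ← cfc_one ℝ H]
    congr 1; ext x; by_cases h : 0 ≤ x <;> simp [s, h]
  · unfold traceNorm
    rw [hH.eq]
    congr 2
    refine CFC.sqrt_unique ?_ ?_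
    · conv_rhs => rw [← hid]
      rw [hmul, ← cfc_mul _ _ H (hc _) (hc _), ← cfc_mul _ _ H (hc _) (hc _)]
      congr 1; ext x; by_cases h : 0 ≤ x <;> simp [s, h]
    · rw [hmul]
      refine cfc_nonneg fun x _ => ?_
      by_cases h : 0 ≤ x <;> simp [s, h]; linarith
  · rw [← Matrix.nonneg_iff_posSemidef, hmul]
    conv_rhs => rhs; rw [← hid]
    rw [← cfc_sub _ _ H (hc _) (hc _)]
    refine cfc_nonneg fun x _ => ?_
    by_cases h : 0 ≤ x <;> simp [s, h]; linarith
  · rw [← Matrix.nonneg_iff_posSemidef, hmul]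
    conv_rhs => rhs; rw [← hid]
    rw [← cfc_add (a := H) _ _ (hc _) (hc _)]
    refine cfc_nonneg fun x _ => ?_
    by_cases h : 0 ≤ x <;> simp [s, h]

/-- If `S` is Hermitian and `S² = 1`, then `1 + S` is half its own square; take `S = ±T`. -/
lemma isContraction_of_mul_self {T : Matrix A A ℂ} (hT : T.IsHermitian) (h : T * T = 1) :
    IsContraction T := by
  have key : ∀ S : Matrix A A ℂ, S.IsHermitian → S * S = 1 → (1 + S).PosSemidef := by
    intro S hS hSS
    have h1 := Matrix.posSemidef_conjTranspose_mul_self (1 + S)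
    have h2 : (1 + S)ᴴ * (1 + S) = (2 : ℂ) • (1 + S) := by
      rw [Matrix.conjTranspose_add, Matrix.conjTranspose_one, hS.eq, add_mul, mul_add, mul_add,
        hSS]
      simp only [one_mul, mul_one, two_smul]; abel
    have h3 : (1 + S) = (1 / 2 : ℂ) • ((1 + S)ᴴ * (1 + S)) := by
      rw [h2, smul_smul]; norm_num
    rw [h3]
    exact h1.smul (by norm_num [Complex.le_def])
  refine ⟨?_, key T hT h⟩
  rw [sub_eq_add_neg]
  exact key (-T) hT.neg (by simp [h])

/-- Add `tr ((|H| - H)(1 + T)) ≥ 0` and `tr ((|H| + H)(1 - T)) ≥ 0`. -/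
lemma trace_mul_le_traceNorm {H T : Matrix A A ℂ} (hH : H.IsHermitian) (hT : IsContraction T) :
    (H * T).trace.re ≤ traceNorm H := by
  obtain ⟨S, -, -, hN, h1, h2⟩ := exists_traceNorm_eq hH
  have e1 := trace_mul_re_nonneg h1 hT.2
  have e2 := trace_mul_re_nonneg h2 hT.1
  rw [hN]
  simp only [sub_mul, mul_add, add_mul, mul_sub, mul_one, Matrix.trace_sub, Matrix.trace_add,
    Complex.sub_re, Complex.add_re] at e1 e2
  linarith

/-- By duality: the `T` optimal for the sum competes, up to sign, in every summand. -/
lemma traceNorm_sum_smul_le {ι : Type} (s : Finset ι) (c : ι → ℝ) {M : ι → Matrix A A ℂ}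
    (hM : ∀ i, (M i).IsHermitian) :
    traceNorm (∑ i ∈ s, (c i : ℂ) • M i) ≤ ∑ i ∈ s, |c i| * traceNorm (M i) := by
  have hH : (∑ i ∈ s, (c i : ℂ) • M i).IsHermitian := by
    refine isSelfAdjoint_sum _ fun i _ => ?_
    show ((c i : ℂ) • M i)ᴴ = _
    rw [Matrix.conjTranspose_smul, (hM i).eq]; simp
  obtain ⟨T, hT, hTT, hN, -, -⟩ := exists_traceNorm_eq hH
  rw [hN, Finset.sum_mul, Matrix.trace_sum, Complex.re_sum]
  refine Finset.sum_le_sum fun i _ => ?_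
  have h1 := trace_mul_le_traceNorm (hM i) (isContraction_of_mul_self hT hTT)
  have h2 := trace_mul_le_traceNorm (hM i) (T := -T)
    (isContraction_of_mul_self hT.neg (by simp [hTT]))
  rw [Matrix.mul_neg, Matrix.trace_neg, Complex.neg_re] at h2
  rw [Matrix.smul_mul, Matrix.trace_smul, smul_eq_mul, Complex.re_ofReal_mul]
  calc _ ≤ |c i * (M i * T).trace.re| := le_abs_self _
    _ = |c i| * |(M i * T).trace.re| := abs_mul _ _
    _ ≤ _ := by gcongr; exact abs_le.mpr ⟨by linarith, h1⟩

/-! ### Block-diagonal operators -/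

lemma trace_proj_kronecker_mul (a : A) (M : Matrix B B ℂ) (T : Matrix (A × B) (A × B) ℂ) :
    ((proj a ⊗ₖ M) * T).trace = (M * diagBlock T a).trace := by
  simp only [Matrix.trace, Matrix.diag, Matrix.mul_apply, Fintype.sum_prod_type, proj,
    Matrix.kroneckerMap_apply, diagBlock, Matrix.of_apply, Matrix.single_apply]
  rw [Finset.sum_eq_single a]
  · refine Finset.sum_congr rfl fun b _ => ?_
    rw [Finset.sum_eq_single a]
    · simp
    · intro c _ hc; simp [Ne.symm hc]
    · simp
  · intro c _ hc; simp [Ne.symm hc]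
  · simp

lemma posSemidef_diagBlock {M : Matrix (A × B) (A × B) ℂ} (hM : M.PosSemidef) (a : A) :
    (diagBlock M a).PosSemidef :=
  hM.submatrix fun b => (a, b)

lemma diagBlock_one (a : A) : diagBlock (1 : Matrix (A × B) (A × B) ℂ) a = 1 := by
  ext b c
  simp [diagBlock, Matrix.one_apply]

lemma IsContraction.diagBlock {T : Matrix (A × B) (A × B) ℂ} (hT : IsContraction T) (a : A) :
    IsContraction (diagBlock T a) := by
  have h1 := posSemidef_diagBlock hT.1 a
  have h2 := posSemidef_diagBlock hT.2 a
  refine ⟨?_, ?_⟩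
  · rw [← diagBlock_one a]; exact h1
  · rw [← diagBlock_one a]; exact h2

lemma isHermitian_proj (a : A) : (proj a).IsHermitian := by
  simp [proj, Matrix.IsHermitian]

lemma isHermitian_kronecker {M : Matrix A A ℂ} {N : Matrix B B ℂ} (hM : M.IsHermitian)
    (hN : N.IsHermitian) : (M ⊗ₖ N).IsHermitian := by
  rw [Matrix.IsHermitian, Matrix.conjTranspose_kronecker, hM.eq, hN.eq]

/-- The diagonal blocks of the optimal `T` are contractions, hence competitors for the single
blocks. -/
lemma traceNorm_sum_proj_kronecker_le {M : A → Matrix B B ℂ} (hM : ∀ a, (M a).IsHermitian) :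
    traceNorm (∑ a, proj a ⊗ₖ M a) ≤ ∑ a, traceNorm (M a) := by
  have hH : (∑ a, proj a ⊗ₖ M a).IsHermitian :=
    isSelfAdjoint_sum _ fun a _ => isHermitian_kronecker (isHermitian_proj a) (hM a)
  obtain ⟨T, hT, hTT, hN, -, -⟩ := exists_traceNorm_eq hH
  rw [hN, Finset.sum_mul, Matrix.trace_sum, Complex.re_sum]
  refine Finset.sum_le_sum fun a _ => ?_
  rw [trace_proj_kronecker_mul]
  exact trace_mul_le_traceNorm (hM a) ((isContraction_of_mul_self hT hTT).diagBlock a)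

lemma sum_abs_le_traceNorm_diagonal (q : A → ℝ) :
    ∑ a, |q a| ≤ traceNorm (Matrix.diagonal fun a => (q a : ℂ)) := by
  let s : A → ℝ := fun a => if 0 ≤ q a then 1 else -1
  have hH : (Matrix.diagonal fun a => (q a : ℂ)).IsHermitian := by
    simp [Matrix.IsHermitian, Matrix.diagonal_conjTranspose, Pi.star_def]
  have hs : IsContraction (Matrix.diagonal fun a => (s a : ℂ)) := by
    refine isContraction_of_mul_self ?_ ?_
    · simp [Matrix.IsHermitian, Matrix.diagonal_conjTranspose, Pi.star_def]
    · rw [Matrix.diagonal_mul_diagonal, ← Matrix.diagonal_one]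
      congr 1; ext a; by_cases h : 0 ≤ q a <;> simp [s, h]
  refine le_trans (le_of_eq ?_) (trace_mul_le_traceNorm hH hs)
  rw [Matrix.diagonal_mul_diagonal, Matrix.trace_diagonal, Complex.re_sum]
  refine Finset.sum_congr rfl fun a _ => ?_
  by_cases h : 0 ≤ q a
  · simp [s, h]
  · simp [s, h, abs_of_neg (not_le.mp h)]

/-- The sign `(-1)^b`. -/
def bitSign (b : Bool) : ℝ := if b then -1 else 1

lemma abs_bitSign (b : Bool) : |bitSign b| = 1 := by cases b <;> simp [bitSign]

/-! ### One-bit extractors and classical distributions -/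

lemma outputSeedState_sub_eq_diagonal {X Y : Type} [Fintype X] [Fintype Y] [DecidableEq Y]
    (C : X → Y → Bool) (p : X → ℝ) :
    outputSeedState C p - fullyMixed Bool ⊗ₖ fullyMixed Y =
      Matrix.diagonal fun w : Bool × Y =>
        (((Fintype.card Y : ℝ)⁻¹ * (∑ x, (if C x w.2 = w.1 then p x else 0) - 1 / 2) : ℝ) : ℂ) := by
  ext ⟨z, v⟩ ⟨z', v'⟩
  simp only [outputSeedState, fullyMixed, Matrix.sub_apply, Matrix.sum_apply, Matrix.smul_apply,
    Matrix.kroneckerMap_apply, proj, Matrix.single_apply, Matrix.one_apply, Matrix.diagonal_apply,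
    smul_eq_mul, Prod.mk.injEq, Fintype.card_bool]
  by_cases hv : v = v'
  · subst hv
    by_cases hz : z = z'
    · subst hz
      have : ∀ x, ∑ y, ((p x : ℂ) * (Fintype.card Y : ℂ)⁻¹) *
          ((if C x y = z ∧ C x y = z then 1 else 0) * (if y = v ∧ y = v then 1 else 0)) =
          (Fintype.card Y : ℂ)⁻¹ * (if C x v = z then (p x : ℂ) else 0) := by
        intro x
        rw [Finset.sum_eq_single v]
        · by_cases h : C x v = z <;> simp [h, mul_comm]
        · intro y _ hy; simp [hy]
        · simp
      rw [Finset.sum_congr rfl fun x _ => this x, ← Finset.mul_sum]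
      simp only [if_true, and_self]
      push_cast
      simp only [apply_ite (Complex.ofReal), Complex.ofReal_zero]
      ring
    · simp only [hz, and_true, if_false]
      simp only [zero_mul, mul_zero, sub_zero]
      refine Finset.sum_eq_zero fun x _ => Finset.sum_eq_zero fun y _ => ?_
      have : ¬ (C x y = z ∧ C x y = z') := fun h => hz (h.1.symm.trans h.2)
      simp [this]
  · simp only [hv, and_false, if_false, mul_zero, sub_zero]
    refine Finset.sum_eq_zero fun x _ => Finset.sum_eq_zero fun y _ => ?_
    have : ¬ (y = v ∧ y = v') := fun h => hv (h.1.symm.trans h.2)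
    simp [this]

/-- The bias of a one-bit extractor on a distribution of high min-entropy. -/
lemma IsStrongExtractor.sum_abs_bias_le {n t : ℕ} {k ε : ℝ}
    {C : BitString n → BitString t → Bool} (hC : IsStrongExtractor k ε C)
    {p : BitString n → ℝ} (hp : p ∈ stdSimplex ℝ (BitString n)) (hk : k ≤ minEntropy p) :
    (2 ^ t : ℝ)⁻¹ * ∑ v, |∑ x, bitSign (C x v) * p x| ≤ 2 * ε := by
  have h := hC p hp hk
  rw [outputSeedState_sub_eq_diagonal] at h
  have h2 := sum_abs_le_traceNorm_diagonal (fun w : Bool × BitString t =>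
    (Fintype.card (BitString t) : ℝ)⁻¹ * (∑ x, (if C x w.2 = w.1 then p x else 0) - 1 / 2))
  rw [Fintype.sum_prod_type_right] at h2
  have hcard : (Fintype.card (BitString t) : ℝ) = 2 ^ t := by simp [BitString]
  rw [hcard] at h h2
  refine le_trans ?_ (h2.trans (by linarith))
  rw [Finset.mul_sum]
  refine Finset.sum_le_sum fun v _ => ?_
  rw [Fintype.sum_bool]
  have hpos : (0 : ℝ) ≤ (2 ^ t : ℝ)⁻¹ := by positivity
  -- The bias is the difference of the deviations of the two outcomes from 1/2.
  have e : ∑ x, bitSign (C x v) * p x =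
      (∑ x, (if C x v = false then p x else 0) - 1 / 2) -
        (∑ x, (if C x v = true then p x else 0) - 1 / 2) := by
    rw [sub_sub_sub_cancel_right, ← Finset.sum_sub_distrib]
    refine Finset.sum_congr rfl fun x _ => ?_
    cases C x v <;> simp [bitSign]
  rw [e, abs_mul, abs_mul, abs_of_nonneg hpos, ← mul_add]
  refine mul_le_mul_of_nonneg_left ?_ hpos
  rw [add_comm]
  exact abs_sub _ _

/-- The bias of a one-bit extractor on an arbitrary nonnegative weight function. -/
lemma IsStrongExtractor.sum_abs_bias_weight_le {n t : ℕ} {k ε : ℝ} (hε : 0 ≤ ε)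
    {C : BitString n → BitString t → Bool} (hC : IsStrongExtractor k ε C)
    {q : BitString n → ℝ} (hq : ∀ x, 0 ≤ q x) {c : ℝ} (hc : ∀ x, q x ≤ c) :
    (2 ^ t : ℝ)⁻¹ * ∑ v, |∑ x, bitSign (C x v) * q x| ≤ 2 * ε * ∑ x, q x + 2 ^ k * c := by
  have hk : (0 : ℝ) < 2 ^ k := Real.rpow_pos_of_pos two_pos k
  have hc0 : 0 ≤ c := (hq fun _ => false).trans (hc _)
  have hQ : 0 ≤ ∑ x, q x := Finset.sum_nonneg fun x _ => hq x
  set Q := ∑ x, q x with hQdef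
  -- If the total mass `Q` is at most `2^k c`, the trivial bound `Q` suffices. Otherwise `q / Q` is
  -- at most `c / Q < 2^(-k)`, so it has min-entropy at least `k`.
  rcases le_or_gt Q (2 ^ k * c) with hle | hlt
  · have hb : ∀ v, |∑ x, bitSign (C x v) * q x| ≤ Q := fun v => by
      refine (Finset.abs_sum_le_sum_abs _ _).trans (le_of_eq ?_)
      refine Finset.sum_congr rfl fun x _ => ?_
      rw [abs_mul, abs_bitSign, one_mul, abs_of_nonneg (hq x)]
    calc _ ≤ (2 ^ t : ℝ)⁻¹ * ∑ _v : BitString t, Q := by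
          gcongr with v; exact hb v
      _ = Q := by simp [BitString]
      _ ≤ 2 * ε * Q + 2 ^ k * c := by have := mul_nonneg (mul_nonneg zero_le_two hε) hQ; linarith
  · have hQ0 : 0 < Q := lt_of_le_of_lt (by positivity) hlt
    have hp : (fun x => Q⁻¹ * q x) ∈ stdSimplex ℝ (BitString n) := by
      refine ⟨fun x => mul_nonneg (by positivity) (hq x), ?_⟩
      rw [← Finset.mul_sum, ← hQdef, inv_mul_cancel₀ hQ0.ne']
    have hmin : k ≤ minEntropy fun x => Q⁻¹ * q x := by
      have hsup : ⨆ x, Q⁻¹ * q x ≤ (2 : ℝ) ^ (-k) := by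
        refine ciSup_le fun x => ?_
        rw [Real.rpow_neg zero_le_two, inv_mul_le_iff₀ hQ0, ← div_eq_mul_inv, le_div_iff₀ hk]
        calc q x * 2 ^ k ≤ c * 2 ^ k := by gcongr; exact hc x
          _ ≤ Q := by rw [mul_comm]; exact hlt.le
      have hpos : 0 < ⨆ x, Q⁻¹ * q x := by
        by_contra hcon
        have hz : ∀ x, Q⁻¹ * q x ≤ 0 := fun x =>
          (le_ciSup (f := fun x => Q⁻¹ * q x) (Set.finite_range _).bddAbove x).trans
            (not_lt.mp hcon)
        have := hp.2
        have h0 : ∑ x, Q⁻¹ * q x ≤ 0 := Finset.sum_nonpos fun x _ => hz x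
        linarith
      rw [minEntropy, le_neg, Real.logb_le_iff_le_rpow one_lt_two hpos]
      exact hsup
    have h := hC.sum_abs_bias_le hp hmin
    have e : ∀ v, |∑ x, bitSign (C x v) * (Q⁻¹ * q x)| =
        Q⁻¹ * |∑ x, bitSign (C x v) * q x| := fun v => by
      rw [← abs_of_pos (inv_pos.mpr hQ0), ← abs_mul, Finset.mul_sum,
        abs_of_pos (inv_pos.mpr hQ0)]
      congr 1
      exact Finset.sum_congr rfl fun x _ => by ring
    rw [Finset.sum_congr rfl fun v _ => e v, ← Finset.mul_sum, mul_left_comm,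
      inv_mul_le_iff₀ hQ0] at h
    have : 0 ≤ 2 ^ k * c := by positivity
    linarith

/-! ### A Cauchy–Schwarz inequality for the trace norm -/

/-- `tr (R X R Y)` is a positive semidefinite form on Hermitian matrices. -/
lemma trace_mul_sandwich_sq_le {R X Y : Matrix A A ℂ} (hR : R.PosSemidef) (hX : X.IsHermitian)
    (hY : Y.IsHermitian) :
    (R * X * R * Y).trace.re ^ 2 ≤ (R * X * R * X).trace.re * (R * Y * R * Y).trace.re := by
  have key : ∀ a b : ℝ, 0 ≤ a ^ 2 * (R * X * R * X).trace.re +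
      2 * a * b * (R * X * R * Y).trace.re + b ^ 2 * (R * Y * R * Y).trace.re := by
    intro a b
    have hZ : ((a : ℂ) • X + (b : ℂ) • Y).IsHermitian := by
      rw [Matrix.IsHermitian, Matrix.conjTranspose_add, Matrix.conjTranspose_smul,
        Matrix.conjTranspose_smul, hX.eq, hY.eq]
      simp
    have h1 := hR.mul_mul_conjTranspose_same ((a : ℂ) • X + (b : ℂ) • Y)
    rw [hZ.eq] at h1
    have h2 := trace_mul_re_nonneg hR h1
    have hc : (R * Y * R * X).trace = (R * X * R * Y).trace := by
      rw [Matrix.mul_assoc (R * Y), Matrix.trace_mul_comm, ← Matrix.mul_assoc]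
    have h3 : (R * (((a : ℂ) • X + (b : ℂ) • Y) * R * ((a : ℂ) • X + (b : ℂ) • Y))).trace =
        ((a ^ 2 : ℝ) : ℂ) * (R * X * R * X).trace + ((2 * a * b : ℝ) : ℂ) * (R * X * R * Y).trace +
          ((b ^ 2 : ℝ) : ℂ) * (R * Y * R * Y).trace := by
      simp only [add_mul, mul_add, Matrix.smul_mul, Matrix.mul_smul, Matrix.trace_add,
        Matrix.trace_smul, smul_eq_mul, ← Matrix.mul_assoc, hc]
      push_cast; ring
    rw [h3] at h2
    simpa only [Complex.add_re, Complex.re_ofReal_mul] using h2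
  set p := (R * X * R * X).trace.re
  set q := (R * X * R * Y).trace.re
  set s := (R * Y * R * Y).trace.re
  have h0 : 0 ≤ s := by simpa using key 0 1
  rcases h0.eq_or_lt with hs | hs
  · have hq : q = 0 := by
      by_contra hq
      -- For `s = 0` the form is affine in `b`; this `b` gives it the value `-1`.
      have h := key 1 (-(p + 1) / (2 * q))
      rw [← hs] at h
      have e : (2 : ℝ) * 1 * (-(p + 1) / (2 * q)) * q = -(p + 1) := by field_simp
      rw [e] at h
      linarith
    rw [hq, ← hs]; simp
  · have h := key s (-q)
    nlinarith

/-- The squared Hilbert–Schmidt norm of the commutator `R T - T R` is `2 tr R² - 2 tr (R T R T)`. -/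
lemma trace_sandwich_unitary_le {R T : Matrix A A ℂ} (hR : R.IsHermitian) (hT : T.IsHermitian)
    (hTT : T * T = 1) : (R * T * R * T).trace.re ≤ (R * R).trace.re := by
  have h := (Matrix.posSemidef_conjTranspose_mul_self (R * T - T * R)).trace_nonneg
  have h := (Complex.le_def.mp h).1
  have e : ((R * T - T * R)ᴴ * (R * T - T * R)).trace =
      2 * (R * R).trace - 2 * (R * T * R * T).trace := by
    rw [Matrix.conjTranspose_sub, Matrix.conjTranspose_mul, Matrix.conjTranspose_mul, hR.eq, hT.eq]
    have e1 : (T * R * (R * T)).trace = (R * R).trace := by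
      rw [Matrix.trace_mul_comm, ← Matrix.mul_assoc, Matrix.mul_assoc R, hTT, mul_one]
    have e2 : (R * T * (T * R)).trace = (R * R).trace := by
      rw [← Matrix.mul_assoc, Matrix.mul_assoc R, hTT, mul_one]
    have e3 : (T * R * (T * R)).trace = (R * T * R * T).trace := by
      rw [Matrix.mul_assoc, Matrix.trace_mul_comm, ← Matrix.mul_assoc]
    have e4 : (R * T * (R * T)).trace = (R * T * R * T).trace := by rw [← Matrix.mul_assoc]
    simp only [sub_mul, mul_sub, Matrix.trace_sub, e1, e2, e3, e4]
    ring
  rw [e] at h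
  simp at h
  linarith

/-- `‖R H R‖_tr² ≤ tr R² · tr (R H R H)`. -/
lemma traceNorm_sandwich_sq_le {R H : Matrix A A ℂ} (hR : R.PosSemidef) (hH : H.IsHermitian) :
    traceNorm (R * H * R) ^ 2 ≤ (R * R).trace.re * (R * H * R * H).trace.re := by
  have hM : (R * H * R).IsHermitian := by
    rw [Matrix.IsHermitian, Matrix.conjTranspose_mul, Matrix.conjTranspose_mul, hR.1.eq, hH.eq,
      Matrix.mul_assoc]
  obtain ⟨T, hT, hTT, hN, -, -⟩ := exists_traceNorm_eq hM
  have h1 := trace_mul_sandwich_sq_le hR hH hT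
  have h2 := trace_sandwich_unitary_le hR.1 hT hTT
  have h3 : 0 ≤ (R * H * R * H).trace.re := by
    have := trace_mul_re_nonneg hR (hR.mul_mul_conjTranspose_same H)
    rwa [hH.eq, ← Matrix.mul_assoc, ← Matrix.mul_assoc] at this
  rw [hN, mul_comm]
  exact h1.trans (mul_le_mul_of_nonneg_left h2 h3)

/-! ### One-bit extractors and quantum side information -/

/-- The square-root factorization underlying the pretty good measurement. -/
lemma exists_pretty_good_measurement {X : Type} [Fintype X] {M : X → Matrix B B ℂ}
    (hM : ∀ x, (M x).PosSemidef) {δ : ℝ} (hδ : 0 < δ) :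
    ∃ (R : Matrix B B ℂ) (F : X → Matrix B B ℂ), R.PosSemidef ∧ (∀ x, (F x).PosSemidef) ∧
      (∀ x, R * F x * R = M x) ∧ R * R = ∑ x, M x + (δ : ℂ) • 1 ∧
      (1 - ∑ x, F x).PosSemidef := by
  have hsum : (∑ x, M x).PosSemidef := Matrix.posSemidef_sum _ fun x _ => hM x
  have hδ1 : ((δ : ℂ) • (1 : Matrix B B ℂ)).PosDef :=
    Matrix.PosDef.one.smul (by exact_mod_cast hδ)
  have hpd : (∑ x, M x + (δ : ℂ) • (1 : Matrix B B ℂ)).PosDef := hδ1.posSemidef_add hsum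
  -- The shift by `δ` makes the root invertible whatever the support of `∑ M x`; its cost is `1 - ∑
  -- F x = δ R⁻²`, which is positive semidefinite.
  set ρ := ∑ x, M x + (δ : ℂ) • (1 : Matrix B B ℂ) with hρ
  have hRR : CFC.sqrt ρ * CFC.sqrt ρ = ρ := CFC.sqrt_mul_sqrt_self ρ hpd.posSemidef.nonneg
  have hR : (CFC.sqrt ρ).PosSemidef := Matrix.nonneg_iff_posSemidef.mp (CFC.sqrt_nonneg ρ)
  set R := CFC.sqrt ρ with hRdef
  have hu : IsUnit R.det := by
    have h := (Matrix.isUnit_iff_isUnit_det _).mp hpd.isUnit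
    rw [← hRR, Matrix.det_mul] at h
    exact isUnit_of_mul_isUnit_left h
  have hi : R⁻¹.PosSemidef := hR.inv
  have hc : ∀ N : Matrix B B ℂ, N.PosSemidef → (R⁻¹ * N * R⁻¹).PosSemidef := fun N hN => by
    have := hN.mul_mul_conjTranspose_same R⁻¹
    rwa [hi.1.eq] at this
  refine ⟨R, fun x => R⁻¹ * M x * R⁻¹, hR, fun x => hc _ (hM x), fun x => ?_, hRR, ?_⟩
  · rw [← Matrix.mul_assoc, ← Matrix.mul_assoc, Matrix.mul_nonsing_inv _ hu, one_mul,
      Matrix.mul_assoc, Matrix.nonsing_inv_mul _ hu, mul_one]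
  · have e : 1 - ∑ x, R⁻¹ * M x * R⁻¹ = R⁻¹ * ((δ : ℂ) • 1) * R⁻¹ := by
      have h1 : R⁻¹ * ρ * R⁻¹ = 1 := by
        rw [← hRR, ← Matrix.mul_assoc, Matrix.nonsing_inv_mul _ hu, one_mul,
          Matrix.mul_nonsing_inv _ hu]
      rw [← Finset.sum_mul, ← Finset.mul_sum]
      conv_lhs => lhs; rw [← h1]
      rw [← sub_mul, ← mul_sub, hρ, add_sub_cancel_left]
    rw [e]
    exact hc _ hδ1.posSemidef

lemma isHermitian_sum_smul {X : Type} [Fintype X] {M : X → Matrix B B ℂ}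
    (hM : ∀ x, (M x).IsHermitian) (c : X → ℝ) : (∑ x, (c x : ℂ) • M x).IsHermitian := by
  refine isSelfAdjoint_sum _ fun x _ => ?_
  show ((c x : ℂ) • M x)ᴴ = _
  rw [Matrix.conjTranspose_smul, (hM x).eq]; simp

/-- The mean square trace norm of the bias of a one-bit extractor in the presence of quantum side
information. -/
lemma IsStrongExtractor.sum_sq_traceNorm_bias_le {n t : ℕ} {k ε : ℝ} (hε : 0 ≤ ε)
    {C : BitString n → BitString t → Bool} (hC : IsStrongExtractor k ε C)
    {M : BitString n → Matrix B B ℂ} (hM : ∀ x, (M x).PosSemidef) {σ : Matrix B B ℂ}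
    (hσ : IsNormalizedState σ) {c : ℝ} (hc : 0 ≤ c)
    (hle : ∀ x, ((c : ℂ) • σ - M x).PosSemidef) :
    (2 ^ t : ℝ)⁻¹ * ∑ v, traceNorm (∑ x, (bitSign (C x v) : ℂ) • M x) ^ 2 ≤
      (∑ x, M x).trace.re * (2 * ε * (∑ x, M x).trace.re + 2 ^ k * c) := by
  have hk : (0 : ℝ) < 2 ^ k := Real.rpow_pos_of_pos two_pos k
  have hρ : (∑ x, M x).PosSemidef := Matrix.posSemidef_sum _ fun x _ => hM x
  have hr : 0 ≤ (∑ x, M x).trace.re := (Complex.le_def.mp hρ.trace_nonneg).1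
  set r := (∑ x, M x).trace.re with hrdef
  have main : ∀ δ : ℝ, 0 < δ →
      (2 ^ t : ℝ)⁻¹ * ∑ v, traceNorm (∑ x, (bitSign (C x v) : ℂ) • M x) ^ 2 ≤
        (r + δ * Fintype.card B) * (2 * ε * r + 2 ^ k * c) := by
    intro δ hδ
    obtain ⟨R, F, hR, hF, hRF, hRR, hF1⟩ := exists_pretty_good_measurement hM hδ
    have htr : (R * R).trace.re = r + δ * Fintype.card B := by
      rw [hRR, Matrix.trace_add, Matrix.trace_smul, Matrix.trace_one, Complex.add_re, smul_eq_mul,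
        Complex.re_ofReal_mul, Complex.natCast_re]
    have hH : ∀ v, (∑ x, (bitSign (C x v) : ℂ) • F x).IsHermitian := fun v =>
      isHermitian_sum_smul (fun x => (hF x).1) _
    have hMv : ∀ v, ∑ x, (bitSign (C x v) : ℂ) • M x =
        R * (∑ x, (bitSign (C x v) : ℂ) • F x) * R := fun v => by
      rw [Finset.mul_sum, Finset.sum_mul]
      refine Finset.sum_congr rfl fun x _ => ?_
      rw [Matrix.mul_smul, Matrix.smul_mul, hRF]
    -- Only the second `H` is expanded, over `x'`; its signs disappear in the absolute values.
    have hquad : ∀ v, (R * (∑ x, (bitSign (C x v) : ℂ) • F x) * R *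
        (∑ x, (bitSign (C x v) : ℂ) • F x)).trace.re ≤
        ∑ x', |∑ x, bitSign (C x v) * (M x * F x').trace.re| := fun v => by
      rw [← hMv, Finset.mul_sum, Matrix.trace_sum, Complex.re_sum]
      refine Finset.sum_le_sum fun x' _ => ?_
      rw [Matrix.mul_smul, Matrix.trace_smul, smul_eq_mul, Complex.re_ofReal_mul, Finset.sum_mul,
        Matrix.trace_sum, Complex.re_sum]
      have e : ∀ x, ((bitSign (C x v) : ℂ) • M x * F x').trace.re =
          bitSign (C x v) * (M x * F x').trace.re := fun x => by
        rw [Matrix.smul_mul, Matrix.trace_smul, smul_eq_mul, Complex.re_ofReal_mul]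
      rw [Finset.sum_congr rfl fun x _ => e x]
      refine (le_abs_self _).trans ?_
      rw [abs_mul, abs_bitSign, one_mul]
    -- The weight is the joint law of `X` and the measurement outcome `x'`.
    have hbias : ∀ x', (2 ^ t : ℝ)⁻¹ * ∑ v, |∑ x, bitSign (C x v) * (M x * F x').trace.re| ≤
        2 * ε * ((∑ x, M x) * F x').trace.re + 2 ^ k * (c * (σ * F x').trace.re) := fun x' => by
      have h := hC.sum_abs_bias_weight_le hε (q := fun x => (M x * F x').trace.re)
        (fun x => trace_mul_re_nonneg (hM x) (hF x')) (c := c * (σ * F x').trace.re) fun x => by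
          have := trace_mul_re_mono (hF x') (hle x)
          rwa [Matrix.smul_mul, Matrix.trace_smul, smul_eq_mul, Complex.re_ofReal_mul] at this
      rwa [Finset.sum_mul, Matrix.trace_sum, Complex.re_sum]
    have hsumF : ∀ N : Matrix B B ℂ, N.PosSemidef →
        ∑ x', (N * F x').trace.re ≤ N.trace.re := fun N hN => by
      have h := trace_mul_re_nonneg hN hF1
      rw [mul_sub, mul_one, Matrix.trace_sub, Complex.sub_re, Finset.mul_sum, Matrix.trace_sum,
        Complex.re_sum] at h
      linarith
    have hrδ : 0 ≤ r + δ * Fintype.card B := by positivity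
    have hσtr : σ.trace.re = 1 := by rw [hσ.2]; simp
    calc (2 ^ t : ℝ)⁻¹ * ∑ v, traceNorm (∑ x, (bitSign (C x v) : ℂ) • M x) ^ 2
        ≤ (2 ^ t : ℝ)⁻¹ * ∑ v, (r + δ * Fintype.card B) *
            ∑ x', |∑ x, bitSign (C x v) * (M x * F x').trace.re| := by
          gcongr with v
          rw [hMv]
          refine (traceNorm_sandwich_sq_le hR (hH v)).trans ?_
          rw [htr]
          exact mul_le_mul_of_nonneg_left (hquad v) hrδ
      _ = (r + δ * Fintype.card B) * ∑ x', (2 ^ t : ℝ)⁻¹ *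
            ∑ v, |∑ x, bitSign (C x v) * (M x * F x').trace.re| := by
          rw [← Finset.mul_sum, mul_left_comm, Finset.sum_comm, Finset.mul_sum]
      _ ≤ (r + δ * Fintype.card B) * ∑ x', (2 * ε * ((∑ x, M x) * F x').trace.re +
            2 ^ k * (c * (σ * F x').trace.re)) := by
          gcongr with x'; exact hbias x'
      _ ≤ (r + δ * Fintype.card B) * (2 * ε * r + 2 ^ k * c) := by
          gcongr
          rw [Finset.sum_add_distrib, ← Finset.mul_sum, ← Finset.mul_sum, ← Finset.mul_sum]
          have h1 := hsumF _ hρ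
          have h2 := hsumF _ hσ.1
          rw [hσtr] at h2
          have h3 : c * ∑ x', (σ * F x').trace.re ≤ c := by
            simpa using mul_le_mul_of_nonneg_left h2 hc
          gcongr
  have hcont : Filter.Tendsto (fun δ : ℝ => (r + δ * Fintype.card B) * (2 * ε * r + 2 ^ k * c))
      (nhdsWithin 0 (Set.Ioi 0)) (nhds (r * (2 * ε * r + 2 ^ k * c))) := by
    have : Continuous fun δ : ℝ => (r + δ * Fintype.card B) * (2 * ε * r + 2 ^ k * c) := by
      fun_prop
    have h := this.tendsto 0
    simp only [zero_mul, add_zero] at h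
    exact h.mono_left nhdsWithin_le_nhds
  exact ge_of_tendsto hcont (by filter_upwards [self_mem_nhdsWithin] with δ hδ using main δ hδ)

lemma isHermitian_ite {M : Matrix B B ℂ} (hM : M.IsHermitian) (p : Prop) [Decidable p] :
    (if p then M else 0).IsHermitian := by
  split_ifs
  exacts [hM, Matrix.isHermitian_zero]

/-- The bias of a one-bit extractor in the presence of quantum side information together with a
classical advice `G`. -/
lemma IsStrongExtractor.sum_traceNorm_bias_advice_le {n t : ℕ} {k ε : ℝ} (hε : 0 ≤ ε)
    {C : BitString n → BitString t → Bool} (hC : IsStrongExtractor k ε C)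
    {M : BitString n → Matrix B B ℂ} (hM : ∀ x, (M x).PosSemidef)
    (htr : (∑ x, M x).trace.re ≤ 1) {σ : Matrix B B ℂ} (hσ : IsNormalizedState σ) {c : ℝ}
    (hc : 0 ≤ c) (hle : ∀ x, ((c : ℂ) • σ - M x).PosSemidef) {Γ : Type} [Fintype Γ]
    [DecidableEq Γ] (G : BitString n → Γ) :
    (2 ^ t : ℝ)⁻¹ * ∑ v, ∑ g,
        traceNorm (∑ x, (bitSign (C x v) : ℂ) • (if G x = g then M x else 0)) ≤
      √(2 * ε + 2 ^ k * c * Fintype.card Γ) := by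
  have hk : (0 : ℝ) < 2 ^ k := Real.rpow_pos_of_pos two_pos k
  let Mg : Γ → BitString n → Matrix B B ℂ := fun g x => if G x = g then M x else 0
  have hMg : ∀ g x, (Mg g x).PosSemidef := fun g x => by
    simp only [Mg]; split_ifs
    exacts [hM x, Matrix.PosSemidef.zero]
  have hleg : ∀ g x, ((c : ℂ) • σ - Mg g x).PosSemidef := fun g x => by
    simp only [Mg]; split_ifs
    · exact hle x
    · rw [sub_zero]; exact hσ.1.smul (by exact_mod_cast hc)
  let a : Γ → ℝ := fun g => (∑ x, Mg g x).trace.re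
  have ha : ∀ g, 0 ≤ a g := fun g =>
    (Complex.le_def.mp (Matrix.posSemidef_sum _ fun x _ => hMg g x).trace_nonneg).1
  have hsum : ∑ g, a g ≤ 1 := by
    refine le_trans (le_of_eq ?_) htr
    simp only [a, Mg]
    rw [← Complex.re_sum, ← Matrix.trace_sum, Finset.sum_comm]
    congr 2
    exact Finset.sum_congr rfl fun x _ => by simp
  let N : Γ → BitString t → ℝ := fun g v => traceNorm (∑ x, (bitSign (C x v) : ℂ) • Mg g x)
  -- Cauchy–Schwarz over the seed turns the mean square bound into a mean bound; a second
  -- Cauchy–Schwarz, over `g`, follows below.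
  have hN : ∀ g, (2 ^ t : ℝ)⁻¹ * ∑ v, N g v ≤ √(a g) * √(2 * ε * a g + 2 ^ k * c) := fun g => by
    rw [← Real.sqrt_mul (ha g)]
    refine Real.le_sqrt_of_sq_le ?_
    refine le_trans ?_ (hC.sum_sq_traceNorm_bias_le hε (hMg g) hσ hc (hleg g))
    have hcs := sq_sum_le_card_mul_sum_sq (s := (Finset.univ : Finset (BitString t))) (f := N g)
    have hcard : ((Finset.univ : Finset (BitString t)).card : ℝ) = 2 ^ t := by
      simp [BitString]
    rw [hcard] at hcs
    calc ((2 ^ t : ℝ)⁻¹ * ∑ v, N g v) ^ 2 = ((2 ^ t : ℝ)⁻¹) ^ 2 * (∑ v, N g v) ^ 2 := by ring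
      _ ≤ ((2 ^ t : ℝ)⁻¹) ^ 2 * (2 ^ t * ∑ v, N g v ^ 2) := by gcongr
      _ = (2 ^ t : ℝ)⁻¹ * ∑ v, N g v ^ 2 := by field_simp
  have hb : ∀ g, 0 ≤ 2 * ε * a g + 2 ^ k * c := fun g => by
    have := ha g; positivity
  calc (2 ^ t : ℝ)⁻¹ * ∑ v, ∑ g, N g v = ∑ g, (2 ^ t : ℝ)⁻¹ * ∑ v, N g v := by
        rw [Finset.sum_comm, Finset.mul_sum]
    _ ≤ ∑ g, √(a g) * √(2 * ε * a g + 2 ^ k * c) := Finset.sum_le_sum fun g _ => hN g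
    _ ≤ √(∑ g, a g) * √(∑ g, (2 * ε * a g + 2 ^ k * c)) :=
        Real.sum_sqrt_mul_sqrt_le _ ha hb
    _ ≤ 1 * √(2 * ε + 2 ^ k * c * Fintype.card Γ) := by
        gcongr
        · exact Real.sqrt_le_one.mpr hsum
        · rw [Finset.sum_add_distrib, ← Finset.mul_sum, Finset.sum_const, Finset.card_univ,
            nsmul_eq_mul]
          have : 2 * ε * ∑ g, a g ≤ 2 * ε := mul_le_of_le_one_right (by positivity) hsum
          linarith
    _ = _ := one_mul _

/-! ### The hybrid argument -/

/-- The probability that a string whose first `i` bits are those of `a`, and whose other bits are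
uniform, equals `z`. -/
noncomputable def hybridWeight {m : ℕ} (i : ℕ) (z a : BitString m) : ℝ :=
  ∏ j : Fin m, if (j : ℕ) < i then (if a j = z j then 1 else 0) else 1 / 2

/-- The analogue of `hybridWeight` that ignores the bit at position `i`. -/
noncomputable def hybridWeightSkip {m : ℕ} (i : Fin m) (z a : BitString m) : ℝ :=
  ∏ j : Fin m, if j < i then (if a j = z j then 1 else 0) else if j = i then 1 else 1 / 2

lemma hybridWeight_zero {m : ℕ} (z a : BitString m) : hybridWeight 0 z a = ((2 : ℝ) ^ m)⁻¹ := by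
  simp [hybridWeight]

lemma hybridWeight_last {m : ℕ} (z a : BitString m) :
    hybridWeight m z a = if a = z then 1 else 0 := by
  simp only [hybridWeight, Fin.is_lt, if_true]
  by_cases h : a = z
  · simp [h]
  · rw [if_neg h]
    obtain ⟨j, hj⟩ := Function.ne_iff.mp h
    exact Finset.prod_eq_zero (Finset.mem_univ j) (by simp [hj])

/-- Consecutive hybrids differ only in factor `i`, where `[a i = z i] - 1/2` is half a product of
signs. -/
lemma hybridWeight_succ_sub {m : ℕ} (i : Fin m) (z a : BitString m) :
    hybridWeight (i + 1) z a - hybridWeight i z a =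
      1 / 2 * bitSign (z i) * hybridWeightSkip i z a * bitSign (a i) := by
  unfold hybridWeight hybridWeightSkip
  rw [← Finset.mul_prod_erase _ _ (Finset.mem_univ i),
    ← Finset.mul_prod_erase (a := i) Finset.univ
      (fun j : Fin m => if (j : ℕ) < i then (if a j = z j then (1 : ℝ) else 0) else 1 / 2)
      (Finset.mem_univ i),
    ← Finset.mul_prod_erase (a := i) Finset.univ
      (fun j : Fin m => if j < i then (if a j = z j then (1 : ℝ) else 0)
        else if j = i then 1 else 1 / 2) (Finset.mem_univ i)]
  have e1 : ∏ j ∈ Finset.univ.erase i,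
      (if (j : ℕ) < i + 1 then (if a j = z j then (1 : ℝ) else 0) else 1 / 2) =
      ∏ j ∈ Finset.univ.erase i,
        (if j < i then (if a j = z j then (1 : ℝ) else 0) else if j = i then 1 else 1 / 2) := by
    refine Finset.prod_congr rfl fun j hj => ?_
    have hji : j ≠ i := Finset.ne_of_mem_erase hj
    have : (j : ℕ) < i + 1 ↔ j < i := by
      rw [Nat.lt_succ_iff_lt_or_eq, Fin.lt_def, Fin.ext_iff.not.mp hji |> or_iff_left]
    simp only [this, hji, if_false]
  have e2 : ∏ j ∈ Finset.univ.erase i,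
      (if (j : ℕ) < i then (if a j = z j then (1 : ℝ) else 0) else 1 / 2) =
      ∏ j ∈ Finset.univ.erase i,
        (if j < i then (if a j = z j then (1 : ℝ) else 0) else if j = i then 1 else 1 / 2) := by
    refine Finset.prod_congr rfl fun j hj => ?_
    have hji : j ≠ i := Finset.ne_of_mem_erase hj
    simp only [Fin.lt_def, hji, if_false]
  rw [e1, e2]
  have e3 : ((if a i = z i then (1 : ℝ) else 0) - 1 / 2) =
      1 / 2 * bitSign (z i) * bitSign (a i) := by
    cases a i <;> cases z i <;> norm_num [bitSign]
  simp only [Nat.lt_succ_self, lt_irrefl, if_true, if_false]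
  rw [← sub_mul, e3]
  ring

lemma hybridWeightSkip_nonneg {m : ℕ} (i : Fin m) (z a : BitString m) :
    0 ≤ hybridWeightSkip i z a :=
  Finset.prod_nonneg fun j _ => by split_ifs <;> norm_num

lemma hybridWeightSkip_congr {m : ℕ} {i : Fin m} (z : BitString m) {a b : BitString m}
    (h : ∀ j < i, a j = b j) : hybridWeightSkip i z a = hybridWeightSkip i z b := by
  refine Finset.prod_congr rfl fun j _ => ?_
  by_cases hj : j < i
  · simp [hj, h j hj]
  · simp [hj]

/-- The ignored position contributes 2 and every other one 1. This 2 cancels the 1/2 in the hybrid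
difference. -/
lemma sum_hybridWeightSkip {m : ℕ} (i : Fin m) (a : BitString m) :
    ∑ z, hybridWeightSkip i z a = 2 := by
  unfold hybridWeightSkip
  have h := Finset.prod_univ_sum (fun _ : Fin m => (Finset.univ : Finset Bool))
    (fun j b => if j < i then (if a j = b then (1 : ℝ) else 0) else if j = i then 1 else 1 / 2)
  rw [Fintype.piFinset_univ] at h
  rw [← h, Finset.prod_eq_single i]
  · simp
  · intro j _ hj
    by_cases hlt : j < i
    · simp [hlt]
    · simp [hlt, hj]
  · simp

/-- Yao's hybrid argument: the distance from uniform of a bit string is bounded by the sum of the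
distances from uniform of its bits, given any advice that determines the preceding bits. -/
lemma sum_traceNorm_le_sum_bias {X : Type} [Fintype X] [Nonempty X] {m : ℕ}
    (a : X → BitString m) {M : X → Matrix B B ℂ} (hM : ∀ x, (M x).IsHermitian)
    {Γ : Fin m → Type} [∀ i, Fintype (Γ i)] [∀ i, DecidableEq (Γ i)] (G : ∀ i, X → Γ i)
    (hG : ∀ i x x', G i x = G i x' → ∀ j < i, a x j = a x' j) :
    ∑ z, traceNorm (∑ x, (((if a x = z then 1 else 0) - (2 ^ m)⁻¹ : ℝ) : ℂ) • M x) ≤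
      ∑ i, ∑ g, traceNorm (∑ x, (bitSign (a x i) : ℂ) • (if G i x = g then M x else 0)) := by
  let D : Fin m → BitString m → Matrix B B ℂ := fun i z =>
    ∑ x, ((hybridWeight (i + 1) z (a x) - hybridWeight i z (a x) : ℝ) : ℂ) • M x
  let N : ∀ i, Γ i → Matrix B B ℂ := fun i g =>
    ∑ x, (bitSign (a x i) : ℂ) • (if G i x = g then M x else 0)
  have hN : ∀ i g, (N i g).IsHermitian := fun i g =>
    isHermitian_sum_smul (fun x => isHermitian_ite (hM x) _) _
  have htel : ∀ z, ∑ x, (((if a x = z then 1 else 0) - (2 ^ m)⁻¹ : ℝ) : ℂ) • M x =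
      ∑ i, ((1 : ℝ) : ℂ) • D i z := fun z => by
    simp only [D, Complex.ofReal_one, one_smul]
    rw [Finset.sum_comm]
    refine Finset.sum_congr rfl fun x _ => ?_
    rw [← Finset.sum_smul, ← Complex.ofReal_sum,
      Fin.sum_univ_eq_sum_range
        (fun i => hybridWeight (i + 1) z (a x) - hybridWeight i z (a x)) m,
      Finset.sum_range_sub (fun i => hybridWeight i z (a x)), hybridWeight_last,
      hybridWeight_zero]
  -- The skipped weight depends on `x` only through its advice, so any preimage of `g` represents
  -- the class. Outside the range of `G i` the choice is harmless, since `N i g` vanishes.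
  have hD : ∀ i z, traceNorm (D i z) ≤
      ∑ g, 1 / 2 * hybridWeightSkip i z (a (Function.invFun (G i) g)) * traceNorm (N i g) := by
    intro i z
    have e : D i z = ∑ g, ((1 / 2 * bitSign (z i) *
        hybridWeightSkip i z (a (Function.invFun (G i) g)) : ℝ) : ℂ) • N i g := by
      simp only [D, N, Finset.smul_sum]
      rw [Finset.sum_comm]
      refine Finset.sum_congr rfl fun x _ => ?_
      rw [Finset.sum_eq_single (G i x)]
      · have h := Function.invFun_eq (f := G i) ⟨x, rfl⟩
        rw [if_pos rfl, smul_smul, ← Complex.ofReal_mul, hybridWeight_succ_sub,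
          hybridWeightSkip_congr z (hG i _ _ h)]
      · intro g _ hg
        rw [if_neg (Ne.symm hg), smul_zero, smul_zero]
      · simp
    rw [e]
    refine (traceNorm_sum_smul_le _ _ (hN i)).trans (le_of_eq ?_)
    refine Finset.sum_congr rfl fun g _ => ?_
    rw [abs_mul, abs_mul, abs_bitSign, abs_of_nonneg (hybridWeightSkip_nonneg _ _ _)]
    norm_num
  have hDh : ∀ i z, (D i z).IsHermitian := fun i z => isHermitian_sum_smul hM _
  calc _ ≤ ∑ z, ∑ i, traceNorm (D i z) := Finset.sum_le_sum fun z _ => by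
        rw [htel]
        simpa using traceNorm_sum_smul_le Finset.univ (fun _ => 1) (fun i => hDh i z)
    _ ≤ ∑ z, ∑ i, ∑ g,
          1 / 2 * hybridWeightSkip i z (a (Function.invFun (G i) g)) * traceNorm (N i g) :=
        Finset.sum_le_sum fun z _ => Finset.sum_le_sum fun i _ => hD i z
    _ = ∑ i, ∑ g, traceNorm (N i g) := by
        rw [Finset.sum_comm]
        refine Finset.sum_congr rfl fun i _ => ?_
        rw [Finset.sum_comm]
        refine Finset.sum_congr rfl fun g _ => ?_
        rw [← Finset.sum_mul, ← Finset.mul_sum, sum_hybridWeightSkip]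
        norm_num

/-! ### Splitting the seed -/

/-- A seed consists of its restriction to `S` and its bits outside of `S`. -/
lemma exists_seed_equiv {d t : ℕ} (S : Finset (Fin d)) (hS : S.card = t) :
    ∃ e : BitString t × ({l // l ∉ S} → Bool) ≃ BitString d,
      (∀ v w, restrict (e (v, w)) S hS = v) ∧ ∀ v w l (h : l ∉ S), e (v, w) l = w ⟨l, h⟩ := by
  let e1 : BitString t ≃ ({l // l ∈ S} → Bool) :=
    Equiv.arrowCongr (S.orderIsoOfFin hS).toEquiv (Equiv.refl Bool)
  let e2 := (Equiv.piEquivPiSubtypeProd (fun l => l ∈ S) fun _ => Bool).symm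
  refine ⟨(Equiv.prodCongr e1 (Equiv.refl _)).trans e2, fun v w => ?_, fun v w l h => ?_⟩
  · ext j
    simp [restrict, e1, e2, Equiv.piEquivPiSubtypeProd, Equiv.arrowCongr,
      ← Finset.coe_orderIsoOfFin_apply]
  · simp [e2, Equiv.piEquivPiSubtypeProd, h]

/-- The advice for the `i`-th bit: the truth tables of the preceding bits as functions of the seed
bits that they share with the `i`-th one. -/
def designAdvice {n t m d : ℕ} (C : BitString n → BitString t → Bool)
    (S : Fin m → Finset (Fin d)) (hS : ∀ i, (S i).card = t) (i : Fin m) (y : BitString d)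
    (x : BitString n) : (Σ j : Finset.Iio i, (↥(S j ∩ S i) → Bool)) → Bool :=
  fun s => C x (restrict
    -- Seed bits in `S i` are erased, so the advice depends on `y` only outside `S i`; the `false`
    -- entries lie outside `S j` and are never read.
    (fun l => if h : l ∈ S s.1 ∩ S i then s.2 ⟨l, h⟩ else (if l ∈ S i then false else y l))
    (S s.1) (hS s.1))

/-- Once the seed is fixed outside `S i`, the advice is one function of `x`, while the bits in `S i`
remain a uniform seed for `C`. -/
lemma designAdvice_congr {n t m d : ℕ} (C : BitString n → BitString t → Bool)
    (S : Fin m → Finset (Fin d)) (hS : ∀ i, (S i).card = t) (i : Fin m) {y y' : BitString d}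
    (h : ∀ l ∉ S i, y l = y' l) : designAdvice C S hS i y = designAdvice C S hS i y' := by
  have : (fun l => if l ∈ S i then false else y l) = fun l => if l ∈ S i then false else y' l := by
    ext l
    split_ifs with hl
    · rfl
    · rw [h l hl]
  ext x s
  unfold designAdvice
  congr 2
  ext l
  split_ifs with h1 h2
  · rfl
  · rfl
  · rw [h l h2]

/-- Evaluate the truth table of bit `j` at the shared bits of the actual seed `y`. -/
lemma trevisanExt_eq_of_designAdvice_eq {n t m d : ℕ} (C : BitString n → BitString t → Bool)
    (S : Fin m → Finset (Fin d)) (hS : ∀ i, (S i).card = t) (i : Fin m) (y : BitString d)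
    {x x' : BitString n} (h : designAdvice C S hS i y x = designAdvice C S hS i y x') (j : Fin m)
    (hj : j < i) : trevisanExt C S hS x y j = trevisanExt C S hS x' y j := by
  have h1 := congrFun h ⟨⟨j, Finset.mem_Iio.mpr hj⟩, fun l => y l⟩
  have e : restrict (fun l => if l ∈ S j ∩ S i then y l else (if l ∈ S i then false else y l))
      (S j) (hS j) = restrict y (S j) (hS j) := by
    ext p
    have hp := Finset.orderEmbOfFin_mem (S j) (hS j) p
    simp only [restrict, Finset.mem_inter, hp, true_and]
    split_ifs <;> rfl
  simp only [designAdvice, dite_eq_ite, e] at h1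
  exact h1

/-- The truth table of bit `j` has `2^|S j ∩ S i|` entries, and the overlap condition bounds their
sum over `j < i`. -/
lemma IsWeakDesign.card_advice_le {t m d : ℕ} {r : ℝ} {S : Fin m → Finset (Fin d)}
    (hS : IsWeakDesign t r S) (i : Fin m) :
    (Fintype.card ((Σ j : Finset.Iio i, (↥(S j ∩ S i) → Bool)) → Bool) : ℝ) ≤ 2 ^ (r * m) := by
  have hcard : Fintype.card ((Σ j : Finset.Iio i, (↥(S j ∩ S i) → Bool)) → Bool) =
      2 ^ ∑ j ∈ Finset.Iio i, 2 ^ (S j ∩ S i).card := by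
    rw [Fintype.card_fun, Fintype.card_bool, Fintype.card_sigma,
      ← Finset.sum_coe_sort (Finset.Iio i)]
    congr 1
    refine Finset.sum_congr rfl fun j _ => ?_
    rw [Fintype.card_fun, Fintype.card_bool, Fintype.card_coe]
  rw [hcard, Nat.cast_pow, Nat.cast_ofNat, ← Real.rpow_natCast]
  refine Real.rpow_le_rpow_of_exponent_le one_le_two ?_
  have := hS.overlap i
  push_cast
  exact this

/-! ### The output state -/

lemma sum_proj_kronecker_apply (M : A → Matrix B B ℂ) (a a' : A) (b b' : B) :
    (∑ c, proj c ⊗ₖ M c) (a, b) (a', b') = if a = a' then M a b b' else 0 := by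
  simp only [Matrix.sum_apply, Matrix.kroneckerMap_apply, proj, Matrix.single_apply]
  by_cases h : a = a'
  · subst h
    rw [Finset.sum_eq_single a]
    · simp
    · intro c _ hc; simp [hc]
    · simp
  · rw [if_neg h]
    refine Finset.sum_eq_zero fun c _ => ?_
    have : ¬ (c = a ∧ c = a') := fun hc => h (hc.1.symm.trans hc.2)
    simp [this]

lemma outputSeedSideState_sub_eq {X Y Z E : Type} [Fintype X] [Fintype Y] [Fintype Z]
    [Fintype E] [DecidableEq Y] [DecidableEq Z] [DecidableEq E] (Ext : X → Y → Z)
    (ρ : Matrix (X × E) (X × E) ℂ) :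
    outputSeedSideState Ext ρ - fullyMixed Z ⊗ₖ (fullyMixed Y ⊗ₖ traceLeft ρ) =
      ∑ z, proj z ⊗ₖ ∑ y, proj y ⊗ₖ ((((Fintype.card Y : ℝ)⁻¹ : ℝ) : ℂ) •
        ∑ x, (((if Ext x y = z then 1 else 0) - (Fintype.card Z : ℝ)⁻¹ : ℝ) : ℂ) •
          diagBlock ρ x) := by
  ext ⟨z, y, e⟩ ⟨z', y', e'⟩
  rw [sum_proj_kronecker_apply (B := Y × E), sum_proj_kronecker_apply]
  simp only [outputSeedSideState, fullyMixed, traceLeft, Matrix.sub_apply, Matrix.sum_apply,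
    Matrix.smul_apply, Matrix.kroneckerMap_apply, proj, Matrix.single_apply, Matrix.one_apply,
    smul_eq_mul]
  by_cases hy : y = y'
  · subst hy
    have hin : ∀ x, ∑ y₁, (Fintype.card Y : ℂ)⁻¹ *
        ((if Ext x y₁ = z ∧ Ext x y₁ = z' then 1 else 0) *
          ((if y₁ = y ∧ y₁ = y then 1 else 0) * diagBlock ρ x e e')) =
        (Fintype.card Y : ℂ)⁻¹ * ((if Ext x y = z ∧ Ext x y = z' then 1 else 0) *
          diagBlock ρ x e e') := fun x => by
      rw [Finset.sum_eq_single y]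
      · simp
      · intro y₁ _ h; simp [h]
      · simp
    rw [Finset.sum_congr rfl fun x _ => hin x]
    by_cases hz : z = z'
    · subst hz
      simp only [if_true, and_self]
      rw [Finset.mul_sum, Finset.mul_sum, Finset.mul_sum, ← Finset.sum_sub_distrib]
      refine Finset.sum_congr rfl fun x _ => ?_
      by_cases hx : Ext x y = z
      · simp only [hx, if_true]; push_cast; ring
      · simp only [hx, if_false]; push_cast; ring
    · have : ∀ x, ¬ (Ext x y = z ∧ Ext x y = z') := fun x hc => hz (hc.1.symm.trans hc.2)
      simp [this, hz]
  · have : ∀ y₁, ¬ (y₁ = y ∧ y₁ = y') := fun y₁ hc => hy (hc.1.symm.trans hc.2)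
    simp [this, hy]

lemma traceNorm_outputSeedSideState_sub_le {X Y Z E : Type} [Fintype X] [Fintype Y] [Fintype Z]
    [Fintype E] [DecidableEq Y] [DecidableEq Z] [DecidableEq E] (Ext : X → Y → Z)
    {ρ : Matrix (X × E) (X × E) ℂ} (hρ : ∀ x, (diagBlock ρ x).IsHermitian) :
    traceNorm (outputSeedSideState Ext ρ - fullyMixed Z ⊗ₖ (fullyMixed Y ⊗ₖ traceLeft ρ)) ≤
      (Fintype.card Y : ℝ)⁻¹ * ∑ y, ∑ z,
        traceNorm (∑ x, (((if Ext x y = z then 1 else 0) - (Fintype.card Z : ℝ)⁻¹ : ℝ) : ℂ) •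
          diagBlock ρ x) := by
  let D : Z → Y → Matrix E E ℂ := fun z y =>
    ∑ x, (((if Ext x y = z then 1 else 0) - (Fintype.card Z : ℝ)⁻¹ : ℝ) : ℂ) • diagBlock ρ x
  have hD : ∀ z y, (D z y).IsHermitian := fun z y => isHermitian_sum_smul hρ _
  have hcD : ∀ z y, ((((Fintype.card Y : ℝ)⁻¹ : ℝ) : ℂ) • D z y).IsHermitian := fun z y => by
    rw [Matrix.IsHermitian, Matrix.conjTranspose_smul, (hD z y).eq]; simp
  have hrow : ∀ z, (∑ y, proj y ⊗ₖ ((((Fintype.card Y : ℝ)⁻¹ : ℝ) : ℂ) • D z y)).IsHermitian :=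
    fun z => isSelfAdjoint_sum _ fun y _ => isHermitian_kronecker (isHermitian_proj y) (hcD z y)
  rw [outputSeedSideState_sub_eq]
  refine (traceNorm_sum_proj_kronecker_le hrow).trans ?_
  rw [Finset.sum_comm, Finset.mul_sum]
  refine Finset.sum_le_sum fun z _ => ?_
  refine (traceNorm_sum_proj_kronecker_le (hcD z)).trans ?_
  rw [Finset.mul_sum]
  refine Finset.sum_le_sum fun y _ => ?_
  have h := traceNorm_sum_smul_le {()} (fun _ => (Fintype.card Y : ℝ)⁻¹) (fun _ => hD z y)
  rw [Finset.sum_singleton, Finset.sum_singleton, abs_of_nonneg (by positivity)] at h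
  exact h

lemma kronecker_one_diagBlock (σ : Matrix B B ℂ) (a : A) :
    diagBlock ((1 : Matrix A A ℂ) ⊗ₖ σ) a = σ := by
  ext b b'
  simp [diagBlock]

lemma trace_traceLeft (ρ : Matrix (A × B) (A × B) ℂ) : (traceLeft ρ).trace = ρ.trace := by
  rw [traceLeft, Matrix.trace_sum, Matrix.trace, Fintype.sum_prod_type]
  rfl

/-- The average over the seed of the biases of the `i`-th output bit of Trevisan's construction,
given the advice. -/
lemma IsStrongExtractor.sum_traceNorm_bias_design_le {n t m d : ℕ} {B : Type} [Fintype B]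
    [DecidableEq B] {k ε : ℝ} (hε : 0 ≤ ε) {C : BitString n → BitString t → Bool}
    (hC : IsStrongExtractor k ε C) (S : Fin m → Finset (Fin d)) (hS : ∀ i, (S i).card = t)
    {M : BitString n → Matrix B B ℂ} (hM : ∀ x, (M x).PosSemidef)
    (htr : (∑ x, M x).trace.re ≤ 1) {σ : Matrix B B ℂ} (hσ : IsNormalizedState σ) {c : ℝ}
    (hc : 0 ≤ c) (hle : ∀ x, ((c : ℂ) • σ - M x).PosSemidef) (i : Fin m) :
    (2 ^ d : ℝ)⁻¹ * ∑ y, ∑ g, traceNorm (∑ x, (bitSign (trevisanExt C S hS x y i) : ℂ) •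
        (if designAdvice C S hS i y x = g then M x else 0)) ≤
      √(2 * ε + 2 ^ k * c *
        Fintype.card ((Σ j : Finset.Iio i, (↥(S j ∩ S i) → Bool)) → Bool)) := by
  obtain ⟨e, he1, he2⟩ := exists_seed_equiv (S i) (hS i)
  have hcard : (2 ^ d : ℝ) = 2 ^ t * Fintype.card ({l // l ∉ S i} → Bool) := by
    have h := Fintype.card_congr e
    rw [Fintype.card_prod] at h
    have h1 : Fintype.card (BitString d) = 2 ^ d := by simp [BitString]
    have h2 : Fintype.card (BitString t) = 2 ^ t := by simp [BitString]
    rw [h1, h2] at h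
    exact_mod_cast h.symm
  have hW : (0 : ℝ) < Fintype.card ({l // l ∉ S i} → Bool) := by
    exact_mod_cast Fintype.card_pos
  rw [← Equiv.sum_comp e, Fintype.sum_prod_type_right, hcard, mul_inv_rev, mul_assoc,
    inv_mul_le_iff₀ hW, Finset.mul_sum, ← nsmul_eq_mul, ← Finset.card_univ, ← Finset.sum_const]
  refine Finset.sum_le_sum fun w _ => ?_
  -- For fixed outside bits `w` the advice is the same for all `v`, so it may be computed at the
  -- all-`false` one.
  have h := hC.sum_traceNorm_bias_advice_le hε hM htr hσ hc hle
    (designAdvice C S hS i (e (fun _ => false, w)))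
  have hG : ∀ v, designAdvice C S hS i (e (v, w)) =
      designAdvice C S hS i (e (fun _ => false, w)) := fun v =>
    designAdvice_congr C S hS i fun l hl => by rw [he2 _ _ l hl, he2 _ _ l hl]
  have hC' : ∀ v x, trevisanExt C S hS x (e (v, w)) i = C x v := fun v x => by
    simp only [trevisanExt, he1]
  simp only [hG, hC']
  exact h

/-- A witness for a lower bound on the min-entropy of a classical-quantum state. -/
lemma exists_block_bound_of_lt_condMinEntropy {X E : Type} [Fintype X] [DecidableEq X]
    [Fintype E] [DecidableEq E] {ρ : Matrix (X × E) (X × E) ℂ} {l : ℝ}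
    (h : (l : EReal) < condMinEntropy ρ) :
    ∃ σ : Matrix E E ℂ, IsNormalizedState σ ∧
      ∀ x, ((((2 : ℝ) ^ (-l) : ℝ) : ℂ) • σ - diagBlock ρ x).PosSemidef := by
  obtain ⟨_, ⟨l', ⟨σ, hσ, hle⟩, rfl⟩, hl⟩ := lt_sSup_iff.mp h
  refine ⟨σ, hσ, fun x => ?_⟩
  have h1 : (((2 : ℝ) ^ (-l') : ℝ) : ℂ) • σ - diagBlock ρ x =
      diagBlock ((((2 : ℝ) ^ (-l') : ℝ) : ℂ) • ((1 : Matrix X X ℂ) ⊗ₖ σ) - ρ) x := by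
    conv_lhs => rw [← kronecker_one_diagBlock σ x]
    rfl
  have h2 : ((((2 : ℝ) ^ (-l') : ℝ) : ℂ) • σ - diagBlock ρ x).PosSemidef := by
    rw [h1]
    exact posSemidef_diagBlock (Matrix.le_iff.mp hle) x
  have hpow : (2 : ℝ) ^ (-l') ≤ (2 : ℝ) ^ (-l) :=
    Real.rpow_le_rpow_of_exponent_le one_le_two (neg_le_neg (EReal.coe_lt_coe_iff.mp hl).le)
  have h3 : ((((2 : ℝ) ^ (-l) - (2 : ℝ) ^ (-l') : ℝ) : ℂ) • σ).PosSemidef :=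
    hσ.1.smul (by exact_mod_cast sub_nonneg.mpr hpow)
  have h4 := h3.add h2
  have h5 : (((2 : ℝ) ^ (-l) - (2 : ℝ) ^ (-l') : ℝ) : ℂ) • σ +
      ((((2 : ℝ) ^ (-l') : ℝ) : ℂ) • σ - diagBlock ρ x) =
      (((2 : ℝ) ^ (-l) : ℝ) : ℂ) • σ - diagBlock ρ x := by
    rw [Complex.ofReal_sub, sub_smul]; abel
  rwa [h5] at h4

end Trevisan

/-- Trevisan's construction, based on a one-bit strong extractor and a weak design, is a
quantum-proof strong extractor with uniform seed. -/
theorem mainTheorem1 {n t m d : ℕ} (k ε r : ℝ) (hε : 0 < ε)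
    (C : Trevisan.BitString n → Trevisan.BitString t → Bool)
    (hC : Trevisan.IsStrongExtractor k ε C)
    (S : Fin m → Finset (Fin d)) (hS : Trevisan.IsWeakDesign t r S) :
    Trevisan.IsQuantumProofStrongExtractor (k + r * m + Real.logb 2 (1 / ε)) (3 * m * √ε)
      (Trevisan.trevisanExt C S hS.card_eq) := by
  open Trevisan in
  intro E _ _ ρ hρ _ hmin
  -- Giving up one bit of entropy makes the inequality strict, so attainment of the supremum is not
  -- needed; the constant 3 leaves room for this.
  obtain ⟨σ, hσ, hle⟩ := exists_block_bound_of_lt_condMinEntropy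
    (l := k + r * m + Real.logb 2 (1 / ε) - 1) (lt_of_lt_of_le (by
      exact_mod_cast sub_one_lt _) hmin)
  set c : ℝ := (2 : ℝ) ^ (-(k + r * m + Real.logb 2 (1 / ε) - 1)) with hcdef
  have hc : 0 ≤ c := Real.rpow_nonneg zero_le_two _
  have hM : ∀ x, (diagBlock ρ x).PosSemidef := posSemidef_diagBlock hρ.1
  have htr : (∑ x, diagBlock ρ x).trace.re ≤ 1 := by
    have := trace_traceLeft ρ
    rw [traceLeft] at this
    rw [this]; exact hρ.2
  -- The advice term is thus `2 ε`, and each bit has bias at most `√(2 ε + 2 ε) = √(4 ε)`.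
  have hkc : 2 ^ k * c * 2 ^ (r * m) = 2 * ε := by
    rw [hcdef, ← Real.rpow_add two_pos, ← Real.rpow_add two_pos]
    have e : k + -(k + r * m + Real.logb 2 (1 / ε) - 1) + r * m = 1 + Real.logb 2 ε := by
      rw [one_div, Real.logb_inv]; ring
    rw [e, Real.rpow_add two_pos, Real.rpow_one, Real.rpow_logb two_pos (by norm_num) hε]
  have hbit : ∀ i, (2 ^ d : ℝ)⁻¹ * ∑ y, ∑ g,
      traceNorm (∑ x, (bitSign (trevisanExt C S hS.card_eq x y i) : ℂ) •
        (if designAdvice C S hS.card_eq i y x = g then diagBlock ρ x else 0)) ≤ 2 * √ε := by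
    intro i
    refine (hC.sum_traceNorm_bias_design_le hε.le S hS.card_eq hM htr hσ hc hle i).trans ?_
    have h4 : 2 * √ε = √(4 * ε) := by
      rw [Real.sqrt_mul (by norm_num), show (4 : ℝ) = 2 ^ 2 by norm_num,
        Real.sqrt_sq zero_le_two]
    rw [h4]
    refine Real.sqrt_le_sqrt ?_
    have h := mul_le_mul_of_nonneg_left (hS.card_advice_le i)
      (mul_nonneg (Real.rpow_nonneg zero_le_two k) hc)
    rw [hkc] at h
    linarith
  have hcard : ∀ j : ℕ, (Fintype.card (BitString j) : ℝ) = 2 ^ j := fun j => by simp [BitString]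
  have h := traceNorm_outputSeedSideState_sub_le (trevisanExt C S hS.card_eq)
    fun x => (hM x).1
  rw [hcard, hcard] at h
  have htot : (2 ^ d : ℝ)⁻¹ * ∑ y, ∑ z, traceNorm (∑ x,
      (((if trevisanExt C S hS.card_eq x y = z then 1 else 0) - (2 ^ m)⁻¹ : ℝ) : ℂ) •
        diagBlock ρ x) ≤ m * (2 * √ε) := by
    calc _ ≤ (2 ^ d : ℝ)⁻¹ * ∑ y, ∑ i, ∑ g,
          traceNorm (∑ x, (bitSign (trevisanExt C S hS.card_eq x y i) : ℂ) •
            (if designAdvice C S hS.card_eq i y x = g then diagBlock ρ x else 0)) := by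
          gcongr with y
          exact sum_traceNorm_le_sum_bias (fun x => trevisanExt C S hS.card_eq x y)
            (fun x => (hM x).1) (fun i => designAdvice C S hS.card_eq i y)
            fun i x x' hxx' j hj => trevisanExt_eq_of_designAdvice_eq C S hS.card_eq i y hxx' j hj
      _ = ∑ i, (2 ^ d : ℝ)⁻¹ * ∑ y, ∑ g,
          traceNorm (∑ x, (bitSign (trevisanExt C S hS.card_eq x y i) : ℂ) •
            (if designAdvice C S hS.card_eq i y x = g then diagBlock ρ x else 0)) := by
          rw [Finset.sum_comm, Finset.mul_sum]
      _ ≤ ∑ _i : Fin m, 2 * √ε := Finset.sum_le_sum fun i _ => hbit i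
      _ = m * (2 * √ε) := by simp
  have hm : 0 ≤ m * √ε := by positivity
  -- Half of `2 m √ε` is `m √ε`, well below the claimed `3 m √ε`.
  linarith
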